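/- **Setting.** Let $O=(X,T,Y)$ with covariates $X$, binary treatment $T\in\{0,1\}$ and real outcome $Y$. A law $\widetilde P$ of $O$ is described by its components: the law $\widetilde P_X$ of $X$, the propensity $\widetilde\pi_a(x)=\widetilde P(T=a\mid X=x)$, and the conditional law of $Y$ given $T=a,X=x$. Fix an arm $t\in\{0,1\}$, a sensitivity parameter $\gamma_t\in\mathbb R$ and a measurable tilting function $s_t:\mathbb R\to\mathbb R$. Write $\widetilde\mu_t(g(Y);x)=E_{\widetilde P}[g(Y)\mid T=t,X=x]$ and $e(Y)=\exp\{\gamma_t s_t(Y)\}$, and define $$\psi_t(\widetilde P)=\int\Big\{\widetilde\mu_t(Y;x)\,\widetilde\pi_t(x)+\frac{\widetilde\mu_t(Ye(Y);x)}{\widetilde\mu_t(e(Y);x)}\,\widetilde\pi_{1-t}(x)\Big\}\,d\widetilde P_X(x),$$ $$\nu_t(\widetilde P)(O)=I(T=t)\Big\{Y+\frac{\widetilde\pi_{1-t}(X)}{\widetilde\pi_t(X)}\Big(\frac{Y e(Y)}{\widetilde\mu_t(e(Y);X)}-\frac{e(Y)\,\widetilde\mu_t(Ye(Y);X)}{\widetilde\mu_t(e(Y);X)^2}\Big)\Big\}+I(T=1-t)\frac{\widetilde\mu_t(Ye(Y);X)}{\widetilde\mu_t(e(Y);X)},$$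 $$\phi_t(\widetilde P)=\nu_t(\widetilde P)-\psi_t(\widetilde P),\qquad \mathrm{Rem}_t(\widetilde P,P)=\psi_t(\widetilde P)-\psi_t(P)+\int\phi_t(\widetilde P)\,dP$$ (ill-defined quotients or integrals, should they occur, are read as $0$). Here $\psi_t(P)$ is the formula that identifies $E[Y(t)]$ under the tilting model, and $\phi_t(P)$ is its efficient influence function. Let $O_1,O_2,\dots$ be i.i.d. with true law $P$, and let $\psi_t=\psi_t(P)$. For each $n$ split $\{1,\dots,n\}$ at random, independently of the data, into $K\ge1$ folds ($K$ fixed), $S_i\in\{1,\dots,K\}$ being the fold of $i$, such that the fold sizes $n_k$ satisfy $n_k/n\to1/K$ in probability. Let $\widehat P^{(-k)}$ be an estimator of $P$ that depends (measurably) only on the split and the observations outside fold $k$, with propensity $\widehat\pi^{(-k)}_t$, and let $$\widetilde\psi_t=\frac1K\sum_{k=1}^K\frac1{n_k}\sum_{i:S_i=k}\nu_t(\widehat P^{(-k)})(O_i).$$ **Theorem 2.** Assume $E[\phi_t(P)(O)^2]<\infty$ and: 1. $|Y|$ and $\exp\{\gamma_t s_t(Y)\}$ are bounded by a constant, $P$-almost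 surely; 2. there is $\epsilon>0$ such that, for all large $n$ and every $k$, almost surely $\epsilon<\widehat\pi_t^{(-k)}(x)<1-\epsilon$ for $P_X$-almost every $x$; 3. $\|\phi_t(\widehat P^{(-k)})-\phi_t(P)\|_{L_2(P)}=o_P(1)$ for every $k$; 4. $|\mathrm{Rem}_t(\widehat P^{(-k)},P)|=o_P(n^{-1/2})$ for every $k$. Then $\sqrt n\,(\widetilde\psi_t-\psi_t)$ converges in distribution to $N\big(0,E[\phi_t(P)(O)^2]\big)$ as $n\to\infty$. -/

import Mathlib

open MeasureTheory ProbabilityTheory Filter Topology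
open scoped ENNReal NNReal

namespace TiltSensitivity

/-- A single observation `O = ((X, T), Y)`: covariates `X`, binary treatment `T`
(`true` is `1`, `false` is `0`) and real outcome `Y`. -/
abbrev Obs (𝒳 : Type*) : Type _ := (𝒳 × Bool) × ℝ

/-- A distribution of `O`, given by its components: the marginal law of `X`, the conditional law
of `T` given `X = x`, and the conditional law of `Y` given `X = x, T = t`.  Nothing is assumed
about the components, and every law of `O` arises in this way because `Bool` and `ℝ` are standard
Borel. -/
structure ObsModel (𝒳 : Type*) [MeasurableSpace 𝒳] where
  /-- law of `X` -/
  covariate : Measure 𝒳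
  /-- law of `T` given `X` -/
  treatment : Kernel 𝒳 Bool
  /-- law of `Y` given `(X, T)` -/
  outcome : Kernel (𝒳 × Bool) ℝ
  covariate_prob : IsProbabilityMeasure covariate
  treatment_markov : IsMarkovKernel treatment
  outcome_markov : IsMarkovKernel outcome

attribute [instance] ObsModel.covariate_prob ObsModel.treatment_markov ObsModel.outcome_markov

noncomputable section

namespace ObsModel

variable {𝒳 : Type*} [MeasurableSpace 𝒳]

/-- The joint law of `O = ((X, T), Y)`. -/
def law (P : ObsModel 𝒳) : Measure (Obs 𝒳) :=
  (P.covariate.compProd P.treatment).compProd P.outcome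

instance (P : ObsModel 𝒳) : IsProbabilityMeasure P.law := by
  unfold law; infer_instance

/-- `π_t(x) = P(T = t ∣ X = x)`. -/
def propensity (P : ObsModel 𝒳) (t : Bool) (x : 𝒳) : ℝ := (P.treatment x).real {t}

/-- `μ_t(g(Y); x) = E[g(Y) ∣ T = t, X = x]`. -/
def condMean (P : ObsModel 𝒳) (t : Bool) (g : ℝ → ℝ) (x : 𝒳) : ℝ :=
  ∫ y, g y ∂(P.outcome (x, t))

/-- `μ_t(exp(γ s(Y)); x)`. -/
def tiltMean (P : ObsModel 𝒳) (γ : ℝ) (s : ℝ → ℝ) (t : Bool) (x : 𝒳) : ℝ :=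
  P.condMean t (fun y => Real.exp (γ * s y)) x

/-- `μ_t(Y exp(γ s(Y)); x)`. -/
def tiltOutcomeMean (P : ObsModel 𝒳) (γ : ℝ) (s : ℝ → ℝ) (t : Bool) (x : 𝒳) : ℝ :=
  P.condMean t (fun y => y * Real.exp (γ * s y)) x

/-- The target functional `ψ_t(P)`: the formula that identifies `E[Y(t)]`,
`E[ μ_t(Y; X) π_t(X) + μ_t(Y exp(γ s(Y)); X) / μ_t(exp(γ s(Y)); X) * π_{1-t}(X) ]`. -/
def psi (P : ObsModel 𝒳) (γ : ℝ) (s : ℝ → ℝ) (t : Bool) : ℝ :=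
  ∫ x, (P.condMean t (fun y => y) x * P.propensity t x
      + P.tiltOutcomeMean γ s t x / P.tiltMean γ s t x * P.propensity (!t) x) ∂P.covariate

/-- The uncentred influence function `ν_t(P)(o) = φ_t(P)(o) + ψ_t(P)`. -/
def nu (P : ObsModel 𝒳) (γ : ℝ) (s : ℝ → ℝ) (t : Bool) (o : Obs 𝒳) : ℝ :=
  let x := o.1.1
  let y := o.2
  (if o.1.2 = t then
      y + y * (P.propensity (!t) x / P.propensity t x)
            * (Real.exp (γ * s y) / P.tiltMean γ s t x)
        - P.propensity (!t) x / P.propensity t x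
            * (Real.exp (γ * s y) * P.tiltOutcomeMean γ s t x / P.tiltMean γ s t x ^ 2)
    else 0)
  + (if o.1.2 = !t then P.tiltOutcomeMean γ s t x / P.tiltMean γ s t x else 0)

/-- The nonparametric efficient influence function `φ_t(P)(o)` of `ψ_t` at `P`. -/
def phi (P : ObsModel 𝒳) (γ : ℝ) (s : ℝ → ℝ) (t : Bool) (o : Obs 𝒳) : ℝ :=
  P.nu γ s t o - P.psi γ s t

/-- The remainder of the von Mises expansion
`ψ_t(Q) = ψ_t(P) - ∫ φ_t(Q) dP + Rem_t(Q, P)`. -/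
def rem (Q P : ObsModel 𝒳) (γ : ℝ) (s : ℝ → ℝ) (t : Bool) : ℝ :=
  Q.psi γ s t - P.psi γ s t + ∫ o, Q.phi γ s t o ∂P.law

/-- A family of distributions that depends measurably on a parameter (here: on the data). -/
structure MeasurableFamily {D : Type*} [MeasurableSpace D] (Q : D → ObsModel 𝒳) : Prop where
  covariate : Measurable fun d => (Q d).covariate
  treatment : Measurable fun p : D × 𝒳 => (Q p.1).treatment p.2
  outcome : Measurable fun p : D × (𝒳 × Bool) => (Q p.1).outcome p.2

end ObsModel

/-- `Z_n = o_P(1)` for nonnegative extended-real-valued `Z_n`. -/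
def IsLittleOPOne {Ω : Type*} [MeasurableSpace Ω] (μ : Measure Ω) (Z : ℕ → Ω → ℝ≥0∞) : Prop :=
  ∀ δ : ℝ≥0∞, 0 < δ → Tendsto (fun n => μ {ω | δ ≤ Z n ω}) atTop (𝓝 0)

/-- The number `n_k` of observations in fold `k` of the split `σ`. -/
def foldSize {n K : ℕ} (σ : Fin n → Fin K) (k : Fin K) : ℕ :=
  (Finset.univ.filter fun i => σ i = k).card

/-- A rule that estimates the law of `O` for sample size `n` and held-out fold `k`: given the
split `σ`, it sees the observations outside fold `k` only. -/
abbrev FoldEstimator (𝒳 : Type*) [MeasurableSpace 𝒳] (K : ℕ) : Type _ :=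
  (n : ℕ) → (k : Fin K) → (σ : Fin n → Fin K) → ({i : Fin n // σ i ≠ k} → Obs 𝒳) → ObsModel 𝒳

/-- `P̂^(-k)` for the split `σ` and the sample `o_1, …, o_n`. -/
def fitWithout {𝒳 : Type*} [MeasurableSpace 𝒳] {K : ℕ} (est : FoldEstimator 𝒳 K) {n : ℕ}
    (k : Fin K) (σ : Fin n → Fin K) (o : Fin n → Obs 𝒳) : ObsModel 𝒳 :=
  est n k σ fun i => o i

/-- The sample-splitting estimator
`(1/K) ∑_k (1/n_k) ∑_{i : σ i = k} ν_t(P̂^(-k))(o_i)`. -/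
def crossFit {𝒳 : Type*} [MeasurableSpace 𝒳] {K : ℕ} (est : FoldEstimator 𝒳 K)
    (γ : ℝ) (s : ℝ → ℝ) (t : Bool) {n : ℕ} (σ : Fin n → Fin K) (o : Fin n → Obs 𝒳) : ℝ :=
  (1 / (K : ℝ)) * ∑ k : Fin K, (1 / (foldSize σ k : ℝ)) *
    ∑ i ∈ Finset.univ.filter (fun i => σ i = k), (fitWithout est k σ o).nu γ s t (o i)

end

end TiltSensitivity

/-! The scaled estimation error is the normalized i.i.d. sum of `φ_t(P)`, to which the central limit
theorem applies, plus one error per fold (`sum_foldError`). By Slutsky it suffices that each fold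
error tends to zero in probability.

Write `φ̂ = φ_t(P̂^(-k))`. The von Mises expansion turns the error of fold `k` into `(√n / K)
Rem_t(P̂^(-k), P)` plus the sum over the fold of `w (φ̂ - ∫ φ̂ dP) - n^(-1/2) φ_t(P)`, where `w = √n
/ (K n_k)` (`foldError_eq`). The first part is negligible by assumption. For the second, fix the
split and the data outside the fold: `φ̂` is then a fixed function and the summands are i.i.d. and
centred, because `φ_t(P)` has mean zero (`integral_phi`). When `|n_k/n - 1/K|` and `‖φ̂ - φ_t(P)‖`
are both below a small `ρ`, the variance of the sum is at most a constant times `ρ ^ 2`, and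
Chebyshev applies (`measure_fold_fluctuation_le`). Independence of fitted function and fold replaces
any restriction on the complexity of the estimators. -/

/-! ### Chebyshev bounds conditional on the training data and on the split. -/

section HeldOut

variable {α : Type*} [MeasurableSpace α]

/-- **Chebyshev's inequality** for a sum of independent centred terms with a common law. -/
theorem measure_pi_le_abs_sum (Q : Measure α) [IsProbabilityMeasure Q] {ι : Type*} [Fintype ι]
    {h : α → ℝ} (hL : MemLp h 2 Q) (hmean : ∫ a, h a ∂Q = 0) {δ : ℝ} (hδ : 0 < δ) :
    Measure.pi (fun _ : ι => Q) {x | δ ≤ |∑ i, h (x i)|} ≤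
      ENNReal.ofReal ((Fintype.card ι * ∫ a, h a ^ 2 ∂Q) / δ ^ 2) := by
  have hcoord (i : ι) : MemLp (fun x : ι → α => h (x i)) 2 (Measure.pi fun _ => Q) :=
    hL.comp_measurePreserving (measurePreserving_eval _ i)
  have hX : MemLp (fun x : ι → α => ∑ i, h (x i)) 2 (Measure.pi fun _ => Q) :=
    memLp_finsetSum _ fun i _ => hcoord i
  have hzero : ∫ x : ι → α, ∑ i, h (x i) ∂(Measure.pi fun _ => Q) = 0 := by
    rw [integral_finsetSum _ fun i _ => (hcoord i).integrable (by norm_num)]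
    refine Finset.sum_eq_zero fun i _ => ?_
    have hi := measurePreserving_eval (fun _ : ι => Q) i
    have := integral_map (f := h) hi.measurable.aemeasurable (by
      rw [hi.map_eq]; exact hL.aestronglyMeasurable)
    rw [hi.map_eq, hmean] at this
    exact this.symm
  have hvar : variance (fun x : ι → α => ∑ i, h (x i)) (Measure.pi fun _ => Q) =
      Fintype.card ι * ∫ a, h a ^ 2 ∂Q := by
    have := variance_sum_pi (μ := fun _ : ι => Q) (X := fun _ => h) fun _ => hL
    rw [show (fun x : ι → α => ∑ i, h (x i)) = ∑ i, fun x : ι → α => h (x i) by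
      ext x; simp, this]
    simp [variance_of_integral_eq_zero hL.aestronglyMeasurable.aemeasurable hmean]
  have := meas_ge_le_variance_div_sq hX hδ
  rw [hzero, hvar] at this
  simpa using this

/-- **Conditional Chebyshev inequality** under sample splitting: a function that is fitted on the
coordinates in `p`, and that is centred with small variance on the event `A`, has a small sum over
the remaining coordinates. -/
theorem measure_pi_heldOut_le (Q : Measure α) [IsProbabilityMeasure Q] {ι : Type*} [Fintype ι]
    (p : ι → Prop) [DecidablePred p] (s : Finset ι) (hs : ∀ i, i ∈ s ↔ ¬ p i)
    {h : ({i // p i} → α) → α → ℝ}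
    (hh : Measurable fun z : ({i // p i} → α) × α => h z.1 z.2) {A : Set ({i // p i} → α)}
    (hA : MeasurableSet A) {η δ : ℝ} (hδ : 0 < δ) (hL : ∀ d ∈ A, MemLp (h d) 2 Q)
    (hmean : ∀ d ∈ A, ∫ a, h d a ∂Q = 0) (hV : ∀ d ∈ A, s.card * ∫ a, h d a ^ 2 ∂Q ≤ η) :
    Measure.pi (fun _ : ι => Q)
        {o | (fun i : {i // p i} => o i) ∈ A ∧
          δ ≤ |∑ i ∈ s, h (fun j : {i // p i} => o j) (o i)|} ≤
      ENNReal.ofReal (η / δ ^ 2) := by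
  classical
  set E : Set (({i // p i} → α) × ({i // ¬ p i} → α)) :=
    {z | z.1 ∈ A ∧ δ ≤ |∑ i, h z.1 (z.2 i)|} with hE
  have hEm : MeasurableSet E := by
    have hsum : Measurable fun z : ({i // p i} → α) × ({i // ¬ p i} → α) =>
        |∑ i, h z.1 (z.2 i)| := by
      refine (Finset.measurable_fun_sum _ fun i _ => ?_).abs
      exact hh.comp (measurable_fst.prodMk ((measurable_pi_apply i).comp measurable_snd))
    exact (measurable_fst hA).inter (measurableSet_le measurable_const hsum)
  have hmp := measurePreserving_piEquivPiSubtypeProd (fun _ : ι => Q) p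
  have hset : {o : ι → α | (fun i : {i // p i} => o i) ∈ A ∧
      δ ≤ |∑ i ∈ s, h (fun j : {i // p i} => o j) (o i)|} =
      MeasurableEquiv.piEquivPiSubtypeProd (fun _ : ι => α) p ⁻¹' E := by
    ext o
    simp only [Set.mem_ofPred_eq, Set.mem_preimage, hE]
    rw [Finset.sum_subtype s hs]
    rfl
  -- By Fubini the training coordinates `d` may be frozen. Each slice with `d ∈ A` obeys the
  -- unconditional inequality with the same bound, and the other slices are empty.
  rw [hset, hmp.measure_preimage hEm.nullMeasurableSet, Measure.prod_apply hEm]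
  calc ∫⁻ d, Measure.pi (fun _ : {i // ¬ p i} => Q) (Prod.mk d ⁻¹' E)
        ∂Measure.pi (fun _ : {i // p i} => Q)
      ≤ ∫⁻ _, ENNReal.ofReal (η / δ ^ 2) ∂Measure.pi (fun _ : {i // p i} => Q) := by
        refine lintegral_mono fun d => ?_
        by_cases hd : d ∈ A
        · have hcard : (Fintype.card {i // ¬ p i} : ℝ) = s.card := by
            rw [Fintype.card_of_subtype s hs]
          refine (measure_mono fun x hx => hx.2).trans
            ((measure_pi_le_abs_sum Q (hL d hd) (hmean d hd) hδ).trans ?_)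
          rw [hcard]
          refine ENNReal.ofReal_le_ofReal ?_
          gcongr
          exact hV d hd
        · simp [hE, hd]
    _ = ENNReal.ofReal (η / δ ^ 2) := by simp

/-- If an event has probability at most `c` for every fixed value of a discrete variable that is
independent of the rest, it has probability at most `c`. -/
theorem measure_le_of_indepFun_of_forall {Ω β γ : Type*} [MeasurableSpace Ω] [MeasurableSpace β]
    [MeasurableSpace γ] [Fintype β] [MeasurableSingletonClass β] (μ : Measure Ω)
    [IsProbabilityMeasure μ] {S : Ω → β} {W : Ω → γ} (hS : Measurable S) (hW : Measurable W)
    (hSW : IndepFun S W μ) {E : β → Set γ} (hE : ∀ b, MeasurableSet (E b)) {c : ℝ≥0∞}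
    (hc : ∀ b, μ.map W (E b) ≤ c) : μ {ω | W ω ∈ E (S ω)} ≤ c := by
  calc μ {ω | W ω ∈ E (S ω)} ≤ μ (⋃ b ∈ (Finset.univ : Finset β), S ⁻¹' {b} ∩ W ⁻¹' E b) := by
        refine measure_mono fun ω hω => ?_
        simpa using hω
    _ ≤ ∑ b, μ (S ⁻¹' {b} ∩ W ⁻¹' E b) := measure_biUnion_finset_le _ _
    _ = ∑ b, μ (S ⁻¹' {b}) * μ (W ⁻¹' E b) := Finset.sum_congr rfl fun b _ =>
        hSW.measure_inter_preimage_eq_mul _ _ (measurableSet_singleton b) (hE b)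
    _ ≤ ∑ b, μ (S ⁻¹' {b}) * c := by
        gcongr with b
        rw [← Measure.map_apply hW (hE b)]
        exact hc b
    _ = c := by
        rw [← Finset.sum_mul, sum_measure_preimage_singleton _
          fun b _ => hS (measurableSet_singleton b)]
        simp

end HeldOut

namespace TiltSensitivity.ObsModel

/-! ### Joint measurability of the functionals in the data and the observation. -/

section Measurability

variable {D 𝒳 : Type*} [MeasurableSpace D] [MeasurableSpace 𝒳] {Q : D → ObsModel 𝒳}

theorem MeasurableFamily.measurable_propensity (hQ : MeasurableFamily Q) (t : Bool) :
    Measurable fun p : D × 𝒳 => (Q p.1).propensity t p.2 :=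
  ((Measure.measurable_coe (measurableSet_singleton t)).comp hQ.treatment).ennreal_toReal

theorem MeasurableFamily.measurable_condMean (hQ : MeasurableFamily Q) (t : Bool) {g : ℝ → ℝ}
    (hg : Measurable g) : Measurable fun p : D × 𝒳 => (Q p.1).condMean t g p.2 := by
  let κ : Kernel (D × 𝒳) ℝ :=
    ⟨fun p => (Q p.1).outcome (p.2, t), hQ.outcome.comp
      (measurable_fst.prodMk (measurable_snd.prodMk measurable_const))⟩
  exact (hg.stronglyMeasurable.integral_kernel (κ := κ)).measurable

theorem MeasurableFamily.measurable_tiltMean (hQ : MeasurableFamily Q) (γ : ℝ) {s : ℝ → ℝ}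
    (hs : Measurable s) (t : Bool) : Measurable fun p : D × 𝒳 => (Q p.1).tiltMean γ s t p.2 :=
  hQ.measurable_condMean t (by fun_prop)

theorem MeasurableFamily.measurable_tiltOutcomeMean (hQ : MeasurableFamily Q) (γ : ℝ) {s : ℝ → ℝ}
    (hs : Measurable s) (t : Bool) :
    Measurable fun p : D × 𝒳 => (Q p.1).tiltOutcomeMean γ s t p.2 :=
  hQ.measurable_condMean t (by fun_prop)

theorem MeasurableFamily.measurable_psi (hQ : MeasurableFamily Q) (γ : ℝ) {s : ℝ → ℝ}
    (hs : Measurable s) (t : Bool) : Measurable fun d => (Q d).psi γ s t := by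
  let κ : Kernel D 𝒳 := ⟨fun d => (Q d).covariate, hQ.covariate⟩
  have : IsMarkovKernel κ := ⟨fun d => (Q d).covariate_prob⟩
  refine (StronglyMeasurable.integral_kernel_prod_right (κ := κ) (f := fun d x =>
    (Q d).condMean t (fun y => y) x * (Q d).propensity t x
      + (Q d).tiltOutcomeMean γ s t x / (Q d).tiltMean γ s t x * (Q d).propensity (!t) x)
    (Measurable.stronglyMeasurable ?_)).measurable
  exact ((hQ.measurable_condMean t measurable_id).mul (hQ.measurable_propensity t)).add
    (((hQ.measurable_tiltOutcomeMean γ hs t).div (hQ.measurable_tiltMean γ hs t)).mul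
      (hQ.measurable_propensity (!t)))

theorem MeasurableFamily.measurable_nu (hQ : MeasurableFamily Q) (γ : ℝ) {s : ℝ → ℝ}
    (hs : Measurable s) (t : Bool) :
    Measurable fun p : D × Obs 𝒳 => (Q p.1).nu γ s t p.2 := by
  have hx : Measurable fun p : D × Obs 𝒳 => (p.1, p.2.1.1) := by fun_prop
  have hπ (b : Bool) := (hQ.measurable_propensity b).comp hx
  have hm := (hQ.measurable_tiltMean γ hs t).comp hx
  have hn := (hQ.measurable_tiltOutcomeMean γ hs t).comp hx
  have ht : Measurable fun p : D × Obs 𝒳 => p.2.1.2 := by fun_prop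
  have hy : Measurable fun p : D × Obs 𝒳 => p.2.2 := by fun_prop
  have he : Measurable fun p : D × Obs 𝒳 => Real.exp (γ * s p.2.2) := by fun_prop
  refine (Measurable.ite (ht (measurableSet_singleton t)) ?_ measurable_const).add
    (Measurable.ite (ht (measurableSet_singleton (!t))) (hn.div hm) measurable_const)
  exact (hy.add ((hy.mul ((hπ (!t)).div (hπ t))).mul (he.div hm))).sub
    (((hπ (!t)).div (hπ t)).mul ((he.mul hn).div (hm.pow_const 2)))

theorem MeasurableFamily.measurable_phi (hQ : MeasurableFamily Q) (γ : ℝ) {s : ℝ → ℝ}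
    (hs : Measurable s) (t : Bool) :
    Measurable fun p : D × Obs 𝒳 => (Q p.1).phi γ s t p.2 :=
  (hQ.measurable_nu γ hs t).sub ((hQ.measurable_psi γ hs t).comp measurable_fst)

theorem measurable_phi (P : ObsModel 𝒳) (γ : ℝ) {s : ℝ → ℝ} (hs : Measurable s) (t : Bool) :
    Measurable (P.phi γ s t) := by
  have hP : MeasurableFamily fun _ : Unit => P :=
    ⟨measurable_const, P.treatment.measurable.comp measurable_snd,
      P.outcome.measurable.comp measurable_snd⟩
  exact (hP.measurable_phi γ hs t).comp (measurable_const (a := ()) |>.prodMk measurable_id)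

end Measurability

/-! ### The influence function at the true law has mean zero. -/

section Centred

variable {𝒳 : Type*} [MeasurableSpace 𝒳]

theorem integral_treatment (P : ObsModel 𝒳) (t : Bool) (x : 𝒳) (f : Bool → ℝ) :
    ∫ b, f b ∂P.treatment x = P.propensity t x * f t + P.propensity (!t) x * f (!t) := by
  rw [integral_fintype .of_finite]
  cases t <;> simp [propensity, add_comm]

theorem propensity_eq_zero_or_of_ae (P : ObsModel 𝒳) (t : Bool) (x : 𝒳) {p : Bool → Prop}
    (h : ∀ᵐ b ∂P.treatment x, p b) : P.propensity t x = 0 ∨ p t := by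
  by_cases hp : p t
  · exact .inr hp
  · refine .inl ?_
    have : P.treatment x {t} = 0 := measure_mono_null (by simpa using hp) h
    simp [propensity, Measure.real, this]

/-- The correction terms of `ν_t(P)` in arm `t` are centred given the covariates. -/
theorem integral_nu_arm (P : ObsModel 𝒳) (γ : ℝ) {s : ℝ → ℝ} (hs : Measurable s) (t : Bool)
    {x : 𝒳} {C : ℝ} (hC : ∀ᵐ y ∂P.outcome (x, t), |y| ≤ C ∧ |Real.exp (γ * s y)| ≤ C) :
    ∫ y, P.nu γ s t ((x, t), y) ∂P.outcome (x, t) = P.condMean t (fun y => y) x := by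
  have iy : Integrable (fun y : ℝ => y) (P.outcome (x, t)) :=
    Integrable.of_bound measurable_id.aestronglyMeasurable C
      (by filter_upwards [hC] with y h using h.1)
  have ie : Integrable (fun y : ℝ => Real.exp (γ * s y)) (P.outcome (x, t)) :=
    Integrable.of_bound (by fun_prop) C (by filter_upwards [hC] with y h using h.2)
  have iye : Integrable (fun y : ℝ => y * Real.exp (γ * s y)) (P.outcome (x, t)) := by
    refine Integrable.of_bound (by fun_prop) (C * C) ?_
    filter_upwards [hC] with y h
    rw [Real.norm_eq_abs, abs_mul]
    exact mul_le_mul h.1 h.2 (abs_nonneg _) ((abs_nonneg _).trans h.1)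
  set r := P.propensity (!t) x / P.propensity t x with hr
  set m := P.tiltMean γ s t x with hm
  set u := P.tiltOutcomeMean γ s t x with hu
  have hnu : ∀ y, P.nu γ s t ((x, t), y) =
      y + (r / m) * (y * Real.exp (γ * s y)) - (r * u / m ^ 2) * Real.exp (γ * s y) := by
    intro y
    simp only [nu, if_true, if_neg (show ¬ t = !t by cases t <;> simp), ← hr, ← hm, ← hu]
    ring
  have hm' : ∫ y, Real.exp (γ * s y) ∂P.outcome (x, t) = m := rfl
  have hu' : ∫ y, y * Real.exp (γ * s y) ∂P.outcome (x, t) = u := rfl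
  have hmpos : m ≠ 0 := by
    rw [← hm']
    exact (integral_exp_pos ie).ne'
  simp_rw [hnu]
  rw [integral_sub (f := fun y => y + r / m * (y * Real.exp (γ * s y)))
      (iy.add (iye.const_mul _)) (ie.const_mul _), integral_add iy (iye.const_mul _),
    integral_const_mul, integral_const_mul, hm', hu']
  -- The two correction terms average to `r u / m` each, whatever the odds `r`; even the default
  -- value of `r` at zero propensity does no harm.
  have : r / m * u - r * u / m ^ 2 * m = 0 := by field_simp; ring
  rw [add_sub_assoc, this, add_zero]
  rfl

/-- Integrating out `Y`, then `T`, then `X` reproduces the integrand of `psi`: arm `t` contributes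
the plain conditional mean, and in the other arm `ν_t` is already a function of `X`. -/
theorem integral_nu (P : ObsModel 𝒳) (γ : ℝ) {s : ℝ → ℝ} (hs : Measurable s) (t : Bool)
    (hint : Integrable (P.nu γ s t) P.law)
    (hC : ∃ C : ℝ, ∀ᵐ o ∂P.law, |o.2| ≤ C ∧ |Real.exp (γ * s o.2)| ≤ C) :
    ∫ o, P.nu γ s t o ∂P.law = P.psi γ s t := by
  obtain ⟨C, hC⟩ := hC
  unfold law at hint hC ⊢
  have hm : Integrable (fun a => ∫ y, P.nu γ s t (a, y) ∂P.outcome a)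
      (P.covariate.compProd P.treatment) := by
    have := hint
    rw [Measure.compProd] at this
    simpa using this.integral_compProd
  rw [Measure.integral_compProd hint, Measure.integral_compProd hm, psi]
  refine integral_congr_ae ?_
  filter_upwards [Measure.ae_ae_of_ae_compProd (Measure.ae_ae_of_ae_compProd hC)] with x hx
  have hother : ∫ y, P.nu γ s t ((x, !t), y) ∂P.outcome (x, !t) =
      P.tiltOutcomeMean γ s t x / P.tiltMean γ s t x := by
    simp [nu]
  rw [P.integral_treatment t x fun b => ∫ y, P.nu γ s t ((x, b), y) ∂P.outcome (x, b), hother]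
  -- The almost sure bounds on `Y` and its tilt pass to `P.outcome (x, t)` only if arm `t` has
  -- positive probability at `x`; otherwise that arm has weight zero on both sides.
  rcases P.propensity_eq_zero_or_of_ae t x hx with h0 | h0
  · rw [h0]; ring
  · rw [P.integral_nu_arm γ hs t h0]; ring

theorem integral_phi (P : ObsModel 𝒳) (γ : ℝ) {s : ℝ → ℝ} (hs : Measurable s) (t : Bool)
    (hint : Integrable (P.phi γ s t) P.law)
    (hC : ∃ C : ℝ, ∀ᵐ o ∂P.law, |o.2| ≤ C ∧ |Real.exp (γ * s o.2)| ≤ C) :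
    ∫ o, P.phi γ s t o ∂P.law = 0 := by
  have hnu : Integrable (P.nu γ s t) P.law := by
    refine (hint.add (integrable_const (P.psi γ s t))).congr (.of_forall fun o => ?_)
    simp [phi]
  have := P.integral_nu γ hs t hnu hC
  simp only [phi]
  rw [integral_sub hnu (integrable_const _), this]
  simp

end Centred

end TiltSensitivity.ObsModel

/-! ### Fluctuation of a fitted function over its held-out fold. -/

section CrossFitting

open TiltSensitivity

variable {α : Type*} [MeasurableSpace α]

/-- The second moment of the weighted difference of a recentred fitted function and its target. -/
theorem integral_weighted_difference_sq_le (Q : Measure α) [IsProbabilityMeasure Q] {f g : α → ℝ}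
    (hf : MemLp f 2 Q) (hf0 : ∫ a, f a ∂Q = 0) (hg : MemLp (fun a => g a - f a) 2 Q) (a b : ℝ) :
    MemLp (fun o => a * (g o - ∫ o, g o ∂Q) - b * f o) 2 Q ∧
      ∫ o, (a * (g o - ∫ o, g o ∂Q) - b * f o) ∂Q = 0 ∧
      ∫ o, (a * (g o - ∫ o, g o ∂Q) - b * f o) ^ 2 ∂Q ≤
        2 * a ^ 2 * ∫ o, (g o - f o) ^ 2 ∂Q + 2 * (a - b) ^ 2 * ∫ o, f o ^ 2 ∂Q := by
  have hg' : MemLp g 2 Q := by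
    refine (hg.add hf).ae_eq (.of_forall fun o => ?_)
    simp
  have ig := hg'.integrable (q := 2) (by norm_num)
  have if' := hf.integrable (q := 2) (by norm_num)
  have hgc : MemLp (fun o => g o - ∫ o, g o ∂Q) 2 Q := hg'.sub (memLp_const _)
  have hh : MemLp (fun o => a * (g o - ∫ o, g o ∂Q) - b * f o) 2 Q :=
    (hgc.const_mul a).sub (hf.const_mul b)
  refine ⟨hh, ?_, ?_⟩
  · rw [integral_sub ((hgc.integrable (by norm_num)).const_mul a) (if'.const_mul b),
      integral_const_mul, integral_const_mul, integral_sub ig (integrable_const _), hf0]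
    simp
  -- As `f` is centred, `g - f` and `g` share their mean, so the summand is `a` times the centred `g
  -- - f` plus `(a - b) f`. Now use `(x + y)² ≤ 2x² + 2y²`, and that centring does not increase the
  -- second moment.
  · have hmean : ∫ o, (g o - f o) ∂Q = ∫ o, g o ∂Q := by rw [integral_sub ig if', hf0, sub_zero]
    have hdc : MemLp (fun o => (g o - f o) - ∫ o, g o ∂Q) 2 Q := hg.sub (memLp_const _)
    have hvar : ∫ o, ((g o - f o) - ∫ o, g o ∂Q) ^ 2 ∂Q ≤ ∫ o, (g o - f o) ^ 2 ∂Q := by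
      have := variance_le_expectation_sq hg.aestronglyMeasurable
      rw [variance_eq_integral hg.aestronglyMeasurable.aemeasurable, hmean] at this
      simpa using this
    calc ∫ o, (a * (g o - ∫ o, g o ∂Q) - b * f o) ^ 2 ∂Q
        ≤ ∫ o, (2 * a ^ 2 * ((g o - f o) - ∫ o, g o ∂Q) ^ 2 + 2 * (a - b) ^ 2 * f o ^ 2) ∂Q := by
          refine integral_mono hh.integrable_sq
            ((hdc.integrable_sq.const_mul _).add (hf.integrable_sq.const_mul _)) fun o => ?_
          dsimp only
          nlinarith [sq_nonneg (a * ((g o - f o) - ∫ o, g o ∂Q) - (a - b) * f o)]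
      _ = 2 * a ^ 2 * ∫ o, ((g o - f o) - ∫ o, g o ∂Q) ^ 2 ∂Q
            + 2 * (a - b) ^ 2 * ∫ o, f o ^ 2 ∂Q := by
          rw [integral_add (hdc.integrable_sq.const_mul _) (hf.integrable_sq.const_mul _),
            integral_const_mul, integral_const_mul]
      _ ≤ _ := by gcongr

/-- The weights `√n / (K n_k)` are close to `1 / √n` when `n_k / n` is close to `1 / K`. -/
theorem fold_weight_bounds {n m K ρ : ℝ} (hn : 0 < n) (hK : 1 ≤ K) (hρ : ρ ≤ 1 / (2 * K))
    (hm : |m / n - 1 / K| < ρ) :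
    0 < m ∧ m * (√n / (K * m)) ^ 2 ≤ 2 ∧
      m * (√n / (K * m) - 1 / √n) ^ 2 ≤ 2 * K * ρ ^ 2 := by
  have hK0 : 0 < K := by linarith
  obtain ⟨q, hq⟩ : ∃ q, q = m / n := ⟨_, rfl⟩
  have hmq : m = q * n := by rw [hq]; field_simp
  rw [← hq] at hm
  have habs := abs_lt.1 hm
  -- The cap on `ρ` keeps the fold fraction `q` away from zero. Both bounds then follow from the
  -- closed forms `1 / (K² q)` and `(q - 1/K)² / q`.
  have hlow : 1 / (2 * K) ≤ q := by
    have : 1 / K = 1 / (2 * K) + 1 / (2 * K) := by field_simp; norm_num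
    linarith [habs.1]
  have hq0 : 0 < q := lt_of_lt_of_le (by positivity) hlow
  have hm0 : 0 < m := by rw [hmq]; positivity
  have hqK : 1 ≤ 2 * K * q := by
    rw [div_le_iff₀ (by positivity)] at hlow
    linarith
  have hsq : √n ^ 2 = n := Real.sq_sqrt hn.le
  have hs0 : 0 < √n := Real.sqrt_pos.2 hn
  have e1 : m * (√n / (K * m)) ^ 2 = 1 / (K ^ 2 * q) := by
    rw [div_pow, hsq, hmq]
    field_simp
  have e2 : m * (√n / (K * m) - 1 / √n) ^ 2 = (q - 1 / K) ^ 2 / q := by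
    have : √n / (K * m) - 1 / √n = (1 / K - q) / (q * √n) := by
      rw [hmq]
      field_simp
      rw [hsq]
      ring
    rw [this, div_pow, mul_pow, hsq, hmq]
    field_simp
    ring
  refine ⟨hm0, ?_, ?_⟩
  · rw [e1, div_le_iff₀ (by positivity)]
    nlinarith
  · have hb : (q - 1 / K) ^ 2 ≤ ρ ^ 2 := by
      rw [← sq_abs]
      gcongr
    rw [e2, div_le_iff₀ hq0]
    nlinarith [sq_nonneg ρ]

theorem mem_filter_eq_iff_not_ne {n K : ℕ} (σ : Fin n → Fin K) (k : Fin K) (i : Fin n) :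
    i ∈ Finset.univ.filter (fun i => σ i = k) ↔ ¬ σ i ≠ k := by simp

/-- Fluctuations over fold `k` of a function that is fitted outside of that fold, when the fold has
about the right size and the fitted function is close to `f`. -/
theorem measure_fold_fluctuation_le (Q : Measure α) [IsProbabilityMeasure Q] {f : α → ℝ}
    (hfm : Measurable f) (hf : MemLp f 2 Q) (hf0 : ∫ a, f a ∂Q = 0)
    {Ω : Type*} [MeasurableSpace Ω] (μ : Measure Ω) [IsProbabilityMeasure μ]
    {n K : ℕ} (hn : 0 < n) (k : Fin K) {S : Ω → Fin n → Fin K} (hS : Measurable S)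
    {W : Ω → Fin n → α} (hW : Measurable W) (hSW : IndepFun S W μ)
    (hlaw : μ.map W = Measure.pi fun _ => Q)
    {g : (σ : Fin n → Fin K) → ({i : Fin n // σ i ≠ k} → α) → α → ℝ}
    (hg : ∀ σ, Measurable fun z : ({i : Fin n // σ i ≠ k} → α) × α => g σ z.1 z.2)
    {ρ δ : ℝ} (hρ0 : 0 < ρ) (hρ : ρ ≤ 1 / (2 * (K : ℝ))) (hδ : 0 < δ) :
    μ {ω | (|(foldSize (S ω) k : ℝ) / n - 1 / (K : ℝ)| < ρ ∧
          eLpNorm (fun a => g (S ω) (fun j => W ω j) a - f a) 2 Q < ENNReal.ofReal ρ) ∧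
        δ ≤ |∑ i ∈ Finset.univ.filter (fun i => S ω i = k),
          (√n / (K * foldSize (S ω) k) *
            (g (S ω) (fun j => W ω j) (W ω i) - ∫ a, g (S ω) (fun j => W ω j) a ∂Q)
            - 1 / √n * f (W ω i))|} ≤
      ENNReal.ofReal ((4 + 4 * K * ∫ a, f a ^ 2 ∂Q) * ρ ^ 2 / δ ^ 2) := by
  have hK : 1 ≤ (K : ℝ) := by exact_mod_cast k.pos
  -- The good event for a fixed split: the size condition is then deterministic, and closeness of
  -- the fit depends on the training data alone.
  let A (σ : Fin n → Fin K) : Set ({i : Fin n // σ i ≠ k} → α) :=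
    {d | |(foldSize σ k : ℝ) / n - 1 / (K : ℝ)| < ρ ∧
      eLpNorm (fun a => g σ d a - f a) 2 Q < ENNReal.ofReal ρ}
  let h (σ : Fin n → Fin K) (d : {i : Fin n // σ i ≠ k} → α) (a : α) : ℝ :=
    √n / (K * foldSize σ k) * (g σ d a - ∫ a, g σ d a ∂Q) - 1 / √n * f a
  have hh (σ) : Measurable fun z : ({i : Fin n // σ i ≠ k} → α) × α => h σ z.1 z.2 := by
    have : Measurable fun d => ∫ a, g σ d a ∂Q :=
      ((hg σ).stronglyMeasurable.integral_prod_right').measurable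
    exact (((hg σ).sub (this.comp measurable_fst)).const_mul _).sub
      ((hfm.comp measurable_snd).const_mul _)
  have hA (σ) : MeasurableSet (A σ) := by
    have hnorm : Measurable fun d => eLpNorm (fun a => g σ d a - f a) 2 Q := by
      simp_rw [eLpNorm_eq_lintegral_rpow_enorm_toReal two_ne_zero ENNReal.ofNat_ne_top]
      refine Measurable.pow_const (Measurable.lintegral_prod_right' (f := fun z :
        ({i : Fin n // σ i ≠ k} → α) × α => ‖g σ z.1 z.2 - f z.2‖ₑ ^ (2 : ℝ≥0∞).toReal) ?_) _
      exact (((hg σ).sub (hfm.comp measurable_snd)).enorm).pow_const _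
    exact (MeasurableSet.const _).inter (measurableSet_lt hnorm measurable_const)
  let E (σ : Fin n → Fin K) : Set (Fin n → α) :=
    {o | (fun j : {i : Fin n // σ i ≠ k} => o j) ∈ A σ ∧
      δ ≤ |∑ i ∈ Finset.univ.filter (fun i => σ i = k),
        h σ (fun j : {i : Fin n // σ i ≠ k} => o j) (o i)|}
  have hr (σ : Fin n → Fin K) :
      Measurable fun (o : Fin n → α) (j : {i : Fin n // σ i ≠ k}) => o j := by fun_prop
  refine measure_le_of_indepFun_of_forall μ hS hW hSW (E := E) (fun σ => ?_) fun σ => ?_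
  · have hsum : Measurable fun o : Fin n → α =>
        |∑ i ∈ Finset.univ.filter (fun i => σ i = k),
          h σ (fun j : {i : Fin n // σ i ≠ k} => o j) (o i)| := by
      refine (Finset.measurable_fun_sum _ fun i _ => ?_).abs
      exact (hh σ).comp ((hr σ).prodMk (measurable_pi_apply i))
    exact (hr σ (hA σ)).inter (measurableSet_le measurable_const hsum)
  · rw [hlaw]
    have key : ∀ d ∈ A σ, MemLp (h σ d) 2 Q ∧ ∫ a, h σ d a ∂Q = 0 ∧
        ((Finset.univ.filter fun i => σ i = k).card : ℝ) * ∫ a, h σ d a ^ 2 ∂Q ≤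
          (4 + 4 * K * ∫ a, f a ^ 2 ∂Q) * ρ ^ 2 := by
      rintro d ⟨hd1, hd2⟩
      have hgm : Measurable (g σ d) := (hg σ).comp measurable_prodMk_left
      have hL : MemLp (fun a => g σ d a - f a) 2 Q :=
        ⟨(hgm.sub hfm).aestronglyMeasurable, hd2.trans ENNReal.ofReal_lt_top⟩
      obtain ⟨k1, k2, k3⟩ := integral_weighted_difference_sq_le Q hf hf0 hL
        (√n / (K * foldSize σ k)) (1 / √n)
      refine ⟨k1, k2, ?_⟩
      obtain ⟨m0, w1, w2⟩ := fold_weight_bounds (Nat.cast_pos.2 hn) hK hρ hd1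
      have hI : ∫ a, (g σ d a - f a) ^ 2 ∂Q ≤ ρ ^ 2 := by
        have := hL.eLpNorm_eq_integral_rpow_norm two_ne_zero ENNReal.ofNat_ne_top
        rw [this, ENNReal.ofReal_lt_ofReal_iff hρ0] at hd2
        have h0 : 0 ≤ ∫ a, (g σ d a - f a) ^ 2 ∂Q := integral_nonneg fun a => sq_nonneg _
        simp only [ENNReal.toReal_ofNat, Real.rpow_ofNat, Real.norm_eq_abs, sq_abs] at hd2
        rw [← one_div, ← Real.sqrt_eq_rpow] at hd2
        exact (Real.sqrt_le_left hρ0.le).1 hd2.le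
      have hF : 0 ≤ ∫ a, f a ^ 2 ∂Q := integral_nonneg fun a => sq_nonneg _
      calc (foldSize σ k : ℝ) * ∫ a, h σ d a ^ 2 ∂Q
          ≤ foldSize σ k * (2 * (√n / (K * foldSize σ k)) ^ 2 * ∫ a, (g σ d a - f a) ^ 2 ∂Q
            + 2 * (√n / (K * foldSize σ k) - 1 / √n) ^ 2 * ∫ a, f a ^ 2 ∂Q) := by
              gcongr
        _ = 2 * (foldSize σ k * (√n / (K * foldSize σ k)) ^ 2) * ∫ a, (g σ d a - f a) ^ 2 ∂Q
            + 2 * (foldSize σ k * (√n / (K * foldSize σ k) - 1 / √n) ^ 2) * ∫ a, f a ^ 2 ∂Q := by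
              ring
        _ ≤ 2 * 2 * ρ ^ 2 + 2 * (2 * K * ρ ^ 2) * ∫ a, f a ^ 2 ∂Q := by gcongr
        _ = _ := by ring
    exact measure_pi_heldOut_le Q (fun i => σ i ≠ k) _ (mem_filter_eq_iff_not_ne σ k) (hh σ) (hA σ)
      hδ (fun d hd => (key d hd).1) (fun d hd => (key d hd).2.1) fun d hd => (key d hd).2.2

/-- A finite sum of sequences that converge to zero in measure converges to zero in measure. -/
theorem tendstoInMeasure_zero_sum {Ω ι κ : Type*} [MeasurableSpace Ω] {μ : Measure Ω} [Fintype κ]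
    {l : Filter ι} {R : κ → ι → Ω → ℝ}
    (hR : ∀ k, TendstoInMeasure μ (R k) l fun _ => 0) :
    TendstoInMeasure μ (fun n ω => ∑ k, R k n ω) l fun _ => 0 := by
  simp only [tendstoInMeasure_iff_norm, sub_zero] at hR ⊢
  intro ε hε
  -- The `+ 1` covers an empty index type and makes the final inequality strict.
  have hc : 0 < ε / (Fintype.card κ + 1 : ℝ) := by positivity
  have hlim : Tendsto (fun n => ∑ k, μ {ω | ε / (Fintype.card κ + 1 : ℝ) ≤ ‖R k n ω‖}) l (𝓝 0) := by
    simpa using tendsto_finsetSum Finset.univ fun k _ => hR k _ hc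
  refine tendsto_of_tendsto_of_tendsto_of_le_of_le tendsto_const_nhds hlim (fun _ => zero_le)
    fun n => ?_
  refine (measure_mono fun ω hω => ?_).trans (measure_biUnion_finset_le Finset.univ _)
  by_contra hcon
  simp only [Finset.mem_univ, Set.iUnion_true, Set.mem_iUnion, Set.mem_ofPred_eq, not_exists,
    not_le] at hcon
  have h1 : ‖∑ k, R k n ω‖ ≤ ∑ _k : κ, ε / (Fintype.card κ + 1 : ℝ) :=
    (norm_sum_le _ _).trans (Finset.sum_le_sum fun k _ => (hcon k).le)
  rw [Finset.sum_const, Finset.card_univ, nsmul_eq_mul] at h1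
  have h2 : (Fintype.card κ : ℝ) * (ε / (Fintype.card κ + 1 : ℝ)) < ε := by
    rw [mul_div_assoc', div_lt_iff₀ (by positivity)]
    linarith
  exact absurd (show ε ≤ ‖∑ k, R k n ω‖ from hω) (not_le.2 (h1.trans_lt h2))

end CrossFitting

/-! ### Decomposition of the estimation error by folds. -/

namespace TiltSensitivity

variable {𝒳 : Type*} [MeasurableSpace 𝒳]

theorem measurable_apply_of_countable {Ω β γ δ : Type*} [MeasurableSpace Ω] [MeasurableSpace β]
    [MeasurableSpace γ] [MeasurableSpace δ] [Countable β] [MeasurableSingletonClass β]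
    {S : Ω → β} (hS : Measurable S) {W : Ω → γ} (hW : Measurable W) {F : β → γ → δ}
    (hF : ∀ b, Measurable (F b)) : Measurable fun ω => F (S ω) (W ω) := by
  have h : Measurable fun p : β × γ => F p.1 p.2 := measurable_from_prod_countable_right hF
  exact h.comp (hS.prodMk hW)

theorem measurable_crossFit {K : ℕ} {est : FoldEstimator 𝒳 K}
    (hest : ∀ n k σ, ObsModel.MeasurableFamily (est n k σ)) (γ : ℝ) {s : ℝ → ℝ}
    (hs : Measurable s) (t : Bool) {n : ℕ} {Ω : Type*} [MeasurableSpace Ω]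
    {S : Ω → Fin n → Fin K} (hS : Measurable S) {W : Ω → Fin n → Obs 𝒳} (hW : Measurable W) :
    Measurable fun ω => crossFit est γ s t (S ω) (W ω) := by
  have hfix (σ : Fin n → Fin K) : Measurable fun o : Fin n → Obs 𝒳 => crossFit est γ s t σ o := by
    have hterm (k : Fin K) (i : Fin n) : Measurable fun o : Fin n → Obs 𝒳 =>
        (fitWithout est k σ o).nu γ s t (o i) := by
      have hr : Measurable fun o : Fin n → Obs 𝒳 =>
          ((fun j : {i : Fin n // σ i ≠ k} => o j), o i) := by fun_prop
      exact ((hest n k σ).measurable_nu γ hs t).comp hr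
    unfold crossFit
    exact (Finset.measurable_fun_sum _ fun k _ =>
      (Finset.measurable_fun_sum _ fun i _ => hterm k i).const_mul _).const_mul _
  exact measurable_apply_of_countable hS hW hfix

/-- The contribution of fold `k` to the difference between the scaled estimation error and the
normalized sum of the influence function at `P`. -/
noncomputable def foldError {K : ℕ} (est : FoldEstimator 𝒳 K) (P : ObsModel 𝒳) (γ : ℝ) (s : ℝ → ℝ)
    (t : Bool) {n : ℕ} (k : Fin K) (σ : Fin n → Fin K) (o : Fin n → Obs 𝒳) : ℝ :=
  √n / K * (1 / (foldSize σ k : ℝ) *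
      (∑ i ∈ Finset.univ.filter (fun i => σ i = k), (fitWithout est k σ o).nu γ s t (o i))
        - P.psi γ s t)
    - 1 / √n * ∑ i ∈ Finset.univ.filter (fun i => σ i = k), P.phi γ s t (o i)

theorem sum_foldError {K : ℕ} (hK : 1 ≤ K) (est : FoldEstimator 𝒳 K) (P : ObsModel 𝒳) (γ : ℝ)
    (s : ℝ → ℝ) (t : Bool) {n : ℕ} (σ : Fin n → Fin K) (o : Fin n → Obs 𝒳) :
    ∑ k, foldError est P γ s t k σ o =
      √n * (crossFit est γ s t σ o - P.psi γ s t) - 1 / √n * ∑ i, P.phi γ s t (o i) := by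
  have hK' : (K : ℝ) ≠ 0 := by positivity
  simp only [foldError, crossFit, Finset.sum_sub_distrib, ← Finset.mul_sum]
  -- The folds partition the sample, so the fold sums of `φ_t(P)` add up to the full sum.
  rw [Finset.sum_fiberwise]
  simp only [Finset.sum_const, Finset.card_univ, Fintype.card_fin, nsmul_eq_mul]
  field_simp

/-- The error of a nonempty fold is a remainder term plus a centred fluctuation. -/
theorem foldError_eq {K : ℕ} (est : FoldEstimator 𝒳 K) (P : ObsModel 𝒳) (γ : ℝ)
    (s : ℝ → ℝ) (t : Bool) {n : ℕ} (k : Fin K) (σ : Fin n → Fin K) (o : Fin n → Obs 𝒳)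
    (hk : (foldSize σ k : ℝ) ≠ 0) :
    foldError est P γ s t k σ o = √n / K * (fitWithout est k σ o).rem P γ s t +
      ∑ i ∈ Finset.univ.filter (fun i => σ i = k),
        (√n / (K * foldSize σ k) * ((fitWithout est k σ o).phi γ s t (o i)
            - ∫ a, (fitWithout est k σ o).phi γ s t a ∂P.law)
          - 1 / √n * P.phi γ s t (o i)) := by
  rw [Finset.sum_sub_distrib, ← Finset.mul_sum, ← Finset.mul_sum, Finset.sum_sub_distrib,
    Finset.sum_const, nsmul_eq_mul]
  change _ = _ + (_ * (_ - (foldSize σ k : ℝ) * _) - _)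
  have hphi : ∑ i ∈ Finset.univ.filter (fun i => σ i = k),
      (fitWithout est k σ o).phi γ s t (o i) =
      ∑ i ∈ Finset.univ.filter (fun i => σ i = k), (fitWithout est k σ o).nu γ s t (o i)
        - foldSize σ k * (fitWithout est k σ o).psi γ s t := by
    simp [ObsModel.phi, Finset.sum_sub_distrib, foldSize]
  have hK : (K : ℝ) ≠ 0 := by exact_mod_cast k.pos.ne'
  rw [hphi, foldError, ObsModel.rem]
  field_simp
  ring

/-- A large fold error forces a badly sized fold, a poor fit, a large remainder, or a large
fluctuation on the good event. For fixed `ρ` the first three have vanishing probability, and the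
last has probability at most a multiple of `ρ ^ 2`. -/
theorem tendstoInMeasure_foldError (t : Bool) (γ : ℝ) {s : ℝ → ℝ} (hs : Measurable s)
    (P : ObsModel 𝒳) {Ω : Type*} [MeasurableSpace Ω] (μ : Measure Ω) [IsProbabilityMeasure μ]
    {O : ℕ → Ω → Obs 𝒳} (hO : ∀ i, Measurable (O i)) (hlaw : ∀ i, μ.map (O i) = P.law)
    (hindep : iIndepFun O μ) {K : ℕ}
    {S : (n : ℕ) → Ω → Fin n → Fin K} (hS : ∀ n, Measurable (S n))
    (hSO : ∀ n, IndepFun (S n) (fun ω (i : Fin n) => O i ω) μ) (k : Fin K)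
    (hbal : TendstoInMeasure μ (fun (n : ℕ) ω => (foldSize (S n ω) k : ℝ) / (n : ℝ)) atTop
      (fun _ => 1 / (K : ℝ)))
    {est : FoldEstimator 𝒳 K} (hest : ∀ n k σ, ObsModel.MeasurableFamily (est n k σ))
    (hvar : MemLp (P.phi γ s t) 2 P.law) (hmean : ∫ o, P.phi γ s t o ∂P.law = 0)
    (hphi : IsLittleOPOne μ fun n ω => eLpNorm (fun o =>
      (fitWithout est k (S n ω) fun i => O i ω).phi γ s t o - P.phi γ s t o) 2 P.law)
    (hrem : IsLittleOPOne μ fun n ω => ENNReal.ofReal (√(n : ℝ) *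
      |(fitWithout est k (S n ω) fun i => O i ω).rem P γ s t|)) :
    TendstoInMeasure μ (fun (n : ℕ) ω => foldError est P γ s t k (S n ω) fun i => O i ω) atTop
      fun _ => 0 := by
  rw [tendstoInMeasure_iff_norm] at hbal ⊢
  intro ε hε
  have hK : 1 ≤ (K : ℝ) := by exact_mod_cast k.pos
  set c : ℝ := 4 + 4 * K * ∫ o, P.phi γ s t o ^ 2 ∂P.law
  rw [ENNReal.tendsto_nhds_zero]
  intro τ hτ
  -- `ρ` is chosen before `n`, so that the Chebyshev bound alone is already below the tolerance `τ`.
  obtain ⟨ρ, hρ0, hρ, hρτ⟩ : ∃ ρ : ℝ, 0 < ρ ∧ ρ ≤ 1 / (2 * (K : ℝ)) ∧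
      ENNReal.ofReal (c * ρ ^ 2 / (ε / 2) ^ 2) < τ := by
    have hlim : Tendsto (fun ρ : ℝ => ENNReal.ofReal (c * ρ ^ 2 / (ε / 2) ^ 2)) (𝓝[>] 0) (𝓝 0) := by
      have : Continuous fun ρ : ℝ => ENNReal.ofReal (c * ρ ^ 2 / (ε / 2) ^ 2) :=
        ENNReal.continuous_ofReal.comp (by fun_prop)
      simpa using (this.tendsto 0).mono_left nhdsWithin_le_nhds
    have hsmall : ∀ᶠ ρ : ℝ in 𝓝[>] 0, ρ ≤ 1 / (2 * (K : ℝ)) :=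
      nhdsWithin_le_nhds (eventually_le_nhds (by positivity))
    obtain ⟨ρ, h1, h2, h3⟩ := (eventually_mem_nhdsWithin.and
      (hsmall.and (hlim.eventually_lt_const hτ))).exists
    exact ⟨ρ, h1, h2, h3⟩
  have hlim : Tendsto (fun n : ℕ =>
      μ {ω | ρ ≤ ‖(foldSize (S n ω) k : ℝ) / (n : ℝ) - 1 / (K : ℝ)‖} +
      μ {ω | ENNReal.ofReal ρ ≤ eLpNorm (fun o =>
        (fitWithout est k (S n ω) fun i => O i ω).phi γ s t o - P.phi γ s t o) 2 P.law} +
      μ {ω | ENNReal.ofReal (ε / 2) ≤ ENNReal.ofReal (√(n : ℝ) *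
        |(fitWithout est k (S n ω) fun i => O i ω).rem P γ s t|)} +
      ENNReal.ofReal (c * ρ ^ 2 / (ε / 2) ^ 2)) atTop
      (𝓝 (0 + 0 + 0 + ENNReal.ofReal (c * ρ ^ 2 / (ε / 2) ^ 2))) :=
    (((hbal ρ hρ0).add (hphi _ (ENNReal.ofReal_pos.2 hρ0))).add
      (hrem _ (ENNReal.ofReal_pos.2 (half_pos hε)))).add tendsto_const_nhds
  simp only [zero_add] at hlim
  filter_upwards [hlim.eventually_lt_const hρτ, eventually_gt_atTop 0] with n hn hn0
  refine le_trans ?_ hn.le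
  have hWlaw : μ.map (fun ω (i : Fin n) => O i ω) = Measure.pi fun _ => P.law := by
    have := (iIndepFun_iff_map_fun_eq_pi_map fun i : Fin n => (hO i).aemeasurable).1
      (hindep.precomp (g := fun i : Fin n => (i : ℕ)) Fin.val_injective)
    simpa [hlaw] using this
  have hfluct := measure_fold_fluctuation_le P.law (P.measurable_phi γ hs t) hvar hmean μ hn0 k
    (hS n) (measurable_pi_lambda _ fun i => hO i) (hSO n) hWlaw
    (g := fun σ d => (est n k σ d).phi γ s t) (fun σ => (hest n k σ).measurable_phi γ hs t)
    hρ0 hρ (half_pos hε)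
  refine le_trans ?_ (add_le_add_right hfluct _)
  refine le_trans (measure_mono ?_) ((measure_union_le _ _).trans
    (add_le_add_left ((measure_union_le _ _).trans (add_le_add_left (measure_union_le _ _) _)) _))
  intro ω hω
  -- Off the four bad events the fold is nonempty, so the decomposition applies and each of its two
  -- parts is below `ε / 2`.
  by_contra hcon
  simp only [Set.mem_union, Set.mem_ofPred_eq, not_or, not_le] at hcon
  obtain ⟨⟨⟨hsize, hnorm⟩, hr⟩, hsum⟩ := hcon
  rw [Real.norm_eq_abs] at hsize
  have hsum' := not_le.1 fun h => hsum ⟨⟨hsize, hnorm⟩, h⟩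
  have hm := (fold_weight_bounds (Nat.cast_pos.2 hn0) hK hρ hsize).1
  have hr' := (ENNReal.ofReal_lt_ofReal_iff (half_pos hε)).1 hr
  have hω' : ε ≤ |foldError est P γ s t k (S n ω) fun i => O i ω| := by
    simpa using hω
  rw [foldError_eq est P γ s t k (S n ω) _ hm.ne'] at hω'
  have hrK : |√n / K * (fitWithout est k (S n ω) fun i => O i ω).rem P γ s t| < ε / 2 := by
    refine lt_of_le_of_lt ?_ hr'
    rw [abs_mul, abs_of_nonneg (by positivity)]
    gcongr
    exact div_le_self (Real.sqrt_nonneg _) hK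
  have := (abs_add_le _ _).trans_lt (add_lt_add hrK hsum')
  rw [add_halves] at this
  exact absurd hω' (not_le.2 this)

end TiltSensitivity

/-! ### Central limit theorem and Slutsky's lemma. -/

theorem theorem2
    {𝒳 : Type*} [MeasurableSpace 𝒳]
    -- treatment arm, sensitivity parameter and tilting function
    (t : Bool) (γ : ℝ) (s : ℝ → ℝ) (hs : Measurable s)
    -- the true law of an observation
    (P : TiltSensitivity.ObsModel 𝒳)
    -- an i.i.d. sample from it
    {Ω : Type*} [MeasurableSpace Ω] (μ : Measure Ω) [IsProbabilityMeasure μ]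
    (O : ℕ → Ω → TiltSensitivity.Obs 𝒳)
    (hO : ∀ i, Measurable (O i)) (hlaw : ∀ i, μ.map (O i) = P.law) (hindep : iIndepFun O μ)
    -- a random split into `K` folds of asymptotically equal size, independent of the sample
    (K : ℕ) (hK : 1 ≤ K)
    (S : (n : ℕ) → Ω → Fin n → Fin K) (hS : ∀ n, Measurable (S n))
    (hSO : ∀ n, IndepFun (S n) (fun ω (i : Fin n) => O i ω) μ)
    (hbal : ∀ k : Fin K, TendstoInMeasure μ
      (fun (n : ℕ) ω => (TiltSensitivity.foldSize (S n ω) k : ℝ) / (n : ℝ)) atTop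
      (fun _ => 1 / (K : ℝ)))
    -- the estimator of the law that is fitted without the held-out fold
    (est : TiltSensitivity.FoldEstimator 𝒳 K)
    (hest : ∀ n k σ, TiltSensitivity.ObsModel.MeasurableFamily (est n k σ))
    -- the limiting variance is finite
    (hvar : MemLp (P.phi γ s t) 2 P.law)
    -- (i) `|Y|` and `exp(γ s(Y))` are bounded
    (h1 : ∃ C : ℝ, ∀ᵐ o ∂P.law, |o.2| ≤ C ∧ |Real.exp (γ * s o.2)| ≤ C)
    -- (ii) the estimated propensity lies in `(ε, 1 - ε)`
    (h2 : ∃ ε : ℝ, 0 < ε ∧ ∀ᶠ n in atTop, ∀ k : Fin K, ∀ᵐ ω ∂μ, ∀ᵐ x ∂P.covariate,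
      ε < (TiltSensitivity.fitWithout est k (S n ω) fun i => O i ω).propensity t x ∧
        (TiltSensitivity.fitWithout est k (S n ω) fun i => O i ω).propensity t x < 1 - ε)
    -- (iii) `‖φ_t(P̂) - φ_t(P)‖_{L₂} = o_P(1)`
    (h3 : ∀ k : Fin K, TiltSensitivity.IsLittleOPOne μ fun n ω =>
      eLpNorm (fun o =>
        (TiltSensitivity.fitWithout est k (S n ω) fun i => O i ω).phi γ s t o - P.phi γ s t o)
        2 P.law)
    -- (iv) `|Rem_t(P̂, P)| = o_P(n^{-1/2})`
    (h4 : ∀ k : Fin K, TiltSensitivity.IsLittleOPOne μ fun n ω =>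
      ENNReal.ofReal (√(n : ℝ) *
        |(TiltSensitivity.fitWithout est k (S n ω) fun i => O i ω).rem P γ s t|)) :
    TendstoInDistribution
      (fun (n : ℕ) ω => √(n : ℝ) *
        (TiltSensitivity.crossFit est γ s t (S n ω) (fun i => O i ω) - P.psi γ s t))
      atTop (fun z : ℝ => z) (fun _ => μ)
      (gaussianReal 0 (∫ o, P.phi γ s t o ^ 2 ∂P.law).toNNReal) := by
  have hint : Integrable (P.phi γ s t) P.law := hvar.integrable (by norm_num)
  have hmean := P.integral_phi γ hs t hint h1
  have hphi := P.measurable_phi γ hs t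
  have hcomp (i : ℕ) (f : TiltSensitivity.Obs 𝒳 → ℝ) (hf : Measurable f) :
      ∫ ω, f (O i ω) ∂μ = ∫ o, f o ∂P.law := by
    rw [← hlaw i, integral_map (hO i).aemeasurable hf.aestronglyMeasurable]
  have hmean0 : ∫ ω, P.phi γ s t (O 0 ω) ∂μ = 0 := by rw [hcomp 0 _ hphi, hmean]
  have hvar0 : variance (fun ω => P.phi γ s t (O 0 ω)) μ = ∫ o, P.phi γ s t o ^ 2 ∂P.law := by
    rw [variance_of_integral_eq_zero (X := fun ω => P.phi γ s t (O 0 ω))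
      (hphi.comp (hO 0)).aemeasurable hmean0]
    exact hcomp 0 (fun o => P.phi γ s t o ^ 2) (hphi.pow_const 2)
  have hclt := tendstoInDistribution_inv_sqrt_mul_sum_sub (P := μ)
    (P' := gaussianReal 0 (∫ o, P.phi γ s t o ^ 2 ∂P.law).toNNReal)
    (X := fun i ω => P.phi γ s t (O i ω)) (Y := fun z => z)
    (by rw [hvar0]; exact HasLaw.id)
    ((hlaw 0 ▸ hvar : MemLp (P.phi γ s t) 2 (μ.map (O 0))).comp_of_map (hO 0).aemeasurable)
    (hindep.comp (fun _ => P.phi γ s t) fun _ => hphi)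
    (fun i => (IdentDistrib.mk (hO i).aemeasurable (hO 0).aemeasurable
      ((hlaw i).trans (hlaw 0).symm)).comp hphi)
  -- Slutsky: the difference from the normalized i.i.d. sum is the sum of the `K` fold errors, which
  -- vanishes in probability.
  refine tendstoInDistribution_of_tendstoInMeasure_sub _ _ hclt ?_ fun n => ?_
  · have hsum := tendstoInMeasure_zero_sum fun k =>
      TiltSensitivity.tendstoInMeasure_foldError t γ hs P μ hO hlaw hindep hS hSO k (hbal k) hest
        hvar hmean (h3 k) (h4 k)
    refine hsum.congr_left fun n => .of_forall fun ω => ?_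
    dsimp only [Pi.sub_apply]
    rw [TiltSensitivity.sum_foldError hK, hmean0, Finset.sum_range]
    simp
  · exact (((TiltSensitivity.measurable_crossFit hest γ hs t (hS n)
      (measurable_pi_lambda _ fun i => hO i)).sub_const _).const_mul _).aemeasurable
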